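/- Let $E$ and $F$ be real Banach lattices and let $T\colon E\to F$ be a continuous linear operator that is order bounded (it maps order bounded sets to order bounded sets) and almost M-weakly compact, that is, $f_n(T(x_n))\to 0$ for every sequence $(x_n)$ of pairwise disjoint elements of the closed unit ball $B_E$ and every weakly convergent sequence $(f_n)$ in the norm dual $F'$. Suppose that the bidual $F''$, with its usual Banach lattice structure, has order continuous norm, that is, $\|\varphi_\alpha\|\downarrow 0$ for every net $(\varphi_\alpha)$ in $F''$ with $\varphi_\alpha\downarrow 0$. Then $T$ is semi-compact: for every $\varepsilon>0$ there is $u\in F$ with $u\ge 0$ such that $T(B_E)\subseteq[-u,u]+\varepsilon B_F$, where $B_F$ is the closed unit ball of $F$. -/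

import Mathlib

open Filter Topology Set
open scoped Pointwise

namespace BanachLattice

/-- The order of the norm dual of an ordered normed space: `f ≤ g` iff `f x ≤ g x` for all `x ≥ 0`.
For a Banach lattice `V` this is the usual order of the Banach lattice `V'`. Applied twice, it is
the usual order of the bidual `V''`. -/
instance dualPreorder {V : Type*} [NormedAddCommGroup V] [NormedSpace ℝ V] [Preorder V] :
    Preorder (StrongDual ℝ V) where
  le f g := ∀ x : V, 0 ≤ x → f x ≤ g x
  le_refl _ _ _ := le_rfl
  le_trans _ _ _ hfg hgh x hx := (hfg x hx).trans (hgh x hx)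

/-- Order continuity of the norm: `‖x i‖ → 0` for every net with `x i ↓ 0` (decreasing, with
infimum `0`). Index sets in the universe of `V` suffice, since the range of a decreasing net is
itself a directed set that can serve as index set. -/
def HasOrderContinuousNorm.{u} (V : Type u) [NormedAddCommGroup V] [Preorder V] : Prop :=
  ∀ (ι : Type u) [Preorder ι] [IsDirectedOrder ι] [Nonempty ι] (x : ι → V),
    Antitone x → IsGLB (range x) 0 → Tendsto (fun i => ‖x i‖) atTop (𝓝 0)

/-- A sequence of pairwise disjoint elements of a vector lattice. -/
def IsDisjointSeq {E : Type*} [AddCommGroup E] [Lattice E] (x : ℕ → E) : Prop :=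
  ∀ m n : ℕ, m ≠ n → |x m| ⊓ |x n| = 0

/-- Weak convergence of a sequence of a normed space to some limit in the space. -/
def IsWeaklyConvergent {X : Type*} [NormedAddCommGroup X] [NormedSpace ℝ X] (x : ℕ → X) : Prop :=
  ∃ a : X, Tendsto (fun n => toWeakSpace ℝ X (x n)) atTop (𝓝 (toWeakSpace ℝ X a))

/-- An operator that maps order bounded sets to order bounded sets. -/
def IsOrderBounded {E F : Type*} [NormedAddCommGroup E] [NormedSpace ℝ E] [Preorder E]
    [NormedAddCommGroup F] [NormedSpace ℝ F] [Preorder F] (T : E →L[ℝ] F) : Prop :=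
  ∀ a b : E, ∃ c d : F, T '' Icc a b ⊆ Icc c d

/-- Almost M-weakly compact operators from a Banach lattice to a Banach space: `f n (T (x n)) → 0`
for all disjoint sequences `x` in the closed unit ball and weakly convergent sequences `f` in the
dual of the codomain. -/
def IsAlmostMWeaklyCompact {E Y : Type*} [NormedAddCommGroup E] [NormedSpace ℝ E] [Lattice E]
    [NormedAddCommGroup Y] [NormedSpace ℝ Y] (T : E →L[ℝ] Y) : Prop :=
  ∀ x : ℕ → E, IsDisjointSeq x → (∀ n, x n ∈ Metric.closedBall (0 : E) 1) →
    ∀ f : ℕ → StrongDual ℝ Y, IsWeaklyConvergent f →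
      Tendsto (fun n => f n (T (x n))) atTop (𝓝 0)

/-- Semi-compact operators from a Banach space to a Banach lattice: for every `ε > 0` there is
`u ≥ 0` such that the image of the closed unit ball lies in `[-u, u] + ε B`. -/
def IsSemicompact {X F : Type*} [NormedAddCommGroup X] [NormedSpace ℝ X]
    [NormedAddCommGroup F] [NormedSpace ℝ F] [Preorder F] (T : X →L[ℝ] F) : Prop :=
  ∀ ε : ℝ, 0 < ε → ∃ u : F, 0 ≤ u ∧
    T '' Metric.closedBall (0 : X) 1 ⊆ Icc (-u) u + ε • Metric.closedBall (0 : F) 1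

end BanachLattice

namespace BanachLattice

/-! Argue by contradiction. If no `u` works for some ε, vectors `x n` of the unit ball can be chosen
recursively so that the part of `T (x n)` exceeding a huge multiple of the earlier `(T (x i))⁺` has
norm above ε/2. `exists_disjointification` trims these excesses to pairwise disjoint `w n ≥ 0` whose
norms stay away from 0 eventually. Take a positive norming functional for `w n` and keep only its
component carried by `w n`. By `le_bandOperator_apply` this component is still at least `‖w n‖` at
`T (x n)`.

These values nevertheless tend to 0. For ψ ≥ 0 in the bidual, the compositions of ψ with the band
projections are positive and their partial sums are bounded by ψ. Order continuity makes the sums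
converge in norm, so the components are weakly null (`tendsto_apply_bandOperator`). For positive
weakly null `f n`, `tendsto_apply_of_weakly_null` extends the almost M-weak compactness of `T` from
disjoint to arbitrary sequences in the ball: a sparse subsequence is disjointified in `E`, and the
discarded parts are small in norm or lie in order intervals, whose images are order bounded and
hence controlled by the `f n`. -/

theorem inf_eq_zero_of_le {G : Type*} [Lattice G] [Zero G] {a b c d : G} (ha : 0 ≤ a) (hb : 0 ≤ b)
    (hac : a ≤ c) (hbd : b ≤ d) (h : c ⊓ d = 0) : a ⊓ b = 0 :=
  le_antisymm ((inf_le_inf hac hbd).trans h.le) (le_inf ha hb)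

/-! ### Disjointness and positive parts in lattice groups -/

section LatticeGroup

variable {G : Type*} [AddCommGroup G] [Lattice G] [IsOrderedAddMonoid G]

theorem inf_add_le_inf_add_inf {a b c : G} (ha : 0 ≤ a) (hb : 0 ≤ b) (hc : 0 ≤ c) :
    a ⊓ (b + c) ≤ a ⊓ b + a ⊓ c := by
  rw [add_inf, inf_add, inf_add]
  refine le_inf (le_inf ?_ ?_) (le_inf ?_ inf_le_right)
  · exact inf_le_left.trans (le_add_of_nonneg_right ha)
  · exact inf_le_left.trans (le_add_of_nonneg_left hb)
  · exact inf_le_left.trans (le_add_of_nonneg_right hc)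

theorem inf_nsmul_eq_zero {a b : G} (ha : 0 ≤ a) (hb : 0 ≤ b) (hab : a ⊓ b = 0) (k : ℕ) :
    a ⊓ k • b = 0 := by
  induction k with
  | zero => simpa using ha
  | succ k ih =>
    refine le_antisymm ?_ (le_inf ha (nsmul_nonneg hb _))
    rw [succ_nsmul]
    exact (inf_add_le_inf_add_inf ha (nsmul_nonneg hb _) hb).trans (by rw [ih, hab, add_zero])

theorem inf_sum_eq_zero {ι : Type*} {a : G} {b : ι → G} (ha : 0 ≤ a) (hb : ∀ i, 0 ≤ b i)
    (s : Finset ι) (hab : ∀ i ∈ s, a ⊓ b i = 0) : a ⊓ ∑ i ∈ s, b i = 0 := by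
  classical
  induction s using Finset.induction_on with
  | empty => simpa using ha
  | insert i s hi ih =>
    refine le_antisymm ?_ (le_inf ha (Finset.sum_nonneg fun i _ => hb i))
    rw [Finset.sum_insert hi]
    refine (inf_add_le_inf_add_inf ha (hb i) (Finset.sum_nonneg fun i _ => hb i)).trans ?_
    rw [ih fun j hj => hab j (Finset.mem_insert_of_mem hj), hab i (Finset.mem_insert_self _ _),
      add_zero]

theorem sum_le_of_pairwise_inf_eq_zero {ι : Type*} {a : ι → G} {x : G} (ha : ∀ i, 0 ≤ a i)
    (hd : ∀ i j, i ≠ j → a i ⊓ a j = 0) (hx : 0 ≤ x) (hax : ∀ i, a i ≤ x) (s : Finset ι) :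
    ∑ i ∈ s, a i ≤ x := by
  classical
  induction s using Finset.induction_on with
  | empty => simpa using hx
  | insert i s hi ih =>
    rw [Finset.sum_insert hi, ← inf_add_sup (a i),
      inf_sum_eq_zero (ha i) ha s fun j hj => hd i j (by rintro rfl; exact hi hj), zero_add]
    exact sup_le (hax i) ih

theorem posPart_sub_inf_posPart_sub (a b : G) : (a - b)⁺ ⊓ (b - a)⁺ = 0 := by
  have := posPart_inf_negPart_eq_zero (a - b)
  rwa [← posPart_neg, neg_sub] at this

theorem sub_posPart_sub (a b : G) : a - (a - b)⁺ = a ⊓ b := by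
  rw [posPart_def, sub_eq_add_neg, neg_sup, add_inf]; simp [inf_comm]

/-- Both `y - (y - u)⁺` and `u - (u - y)⁺` equal `y ⊓ u`, and `(-y - u)⁺ ≤ (u - y)⁺` because `-u ≤
u`. -/
theorem sub_posPart_add_posPart_le {y u : G} (hu : 0 ≤ u) :
    y - (y - u)⁺ + (-y - u)⁺ ≤ u := by
  have h1 : (-y - u)⁺ ≤ (u - y)⁺ := by
    apply posPart_mono
    rw [sub_eq_add_neg, sub_eq_add_neg, add_comm]
    gcongr
    exact (neg_nonpos.2 hu).trans hu
  have h2 : u - (u - y)⁺ = y - (y - u)⁺ := by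
    rw [sub_posPart_sub, sub_posPart_sub, inf_comm]
  rw [← h2]
  exact (add_le_add_right h1 _).trans (by simp)

theorem posPart_sub_le_add {x q r : G} (hr : 0 ≤ r) : (x - q)⁺ ≤ (x - q - r)⁺ + r := by
  rw [posPart_def]
  refine sup_le ?_ (add_nonneg (posPart_nonneg _) hr)
  calc x - q = (x - q - r) + r := by abel
    _ ≤ _ := by gcongr; exact le_posPart _

end LatticeGroup

section SolidNorm

variable {E : Type*} [NormedAddCommGroup E] [Lattice E] [IsOrderedAddMonoid E] [HasSolidNorm E]

theorem norm_le_norm_of_nonneg_of_le {a b : E} (ha : 0 ≤ a) (hab : a ≤ b) : ‖a‖ ≤ ‖b‖ :=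
  norm_le_norm_of_abs_le_abs (by rwa [abs_of_nonneg ha, abs_of_nonneg (ha.trans hab)])

theorem norm_posPart_le (a : E) : ‖a⁺‖ ≤ ‖a‖ := by
  rw [← norm_abs_eq_norm a]
  exact norm_le_norm_of_nonneg_of_le (posPart_nonneg a) (sup_le (le_abs_self a) (abs_nonneg a))

theorem norm_negPart_le (a : E) : ‖a⁻‖ ≤ ‖a‖ := by
  rw [← norm_abs_eq_norm a]
  exact norm_le_norm_of_nonneg_of_le (negPart_nonneg a) (sup_le (neg_le_abs a) (abs_nonneg a))

end SolidNorm

theorem smul_posPart_of_pos {E : Type*} [AddCommGroup E] [Module ℝ E] [Lattice E] [IsOrderedModule ℝ E]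
    {c : ℝ} (hc : 0 < c) (a : E) : c • a⁺ = (c • a)⁺ := by
  rw [posPart_def, posPart_def]
  apply le_antisymm
  · rw [← le_inv_smul_iff_of_pos hc]
    refine sup_le ?_ ?_
    · rw [le_inv_smul_iff_of_pos hc]; exact le_sup_left
    · exact smul_nonneg (inv_nonneg.2 hc.le) le_sup_right
  · exact sup_le (smul_le_smul_of_nonneg_left le_sup_left hc.le)
      (smul_nonneg hc.le le_sup_right)

/-! ### Disjointification of bounded positive sequences -/

section Disjointification

variable {E : Type*} [NormedAddCommGroup E] [NormedSpace ℝ E] [CompleteSpace E] [Lattice E]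
    [IsOrderedAddMonoid E] [IsOrderedModule ℝ E] [HasSolidNorm E]

/-- With `s = ∑ 2⁻ⁿ xₙ` and `i < j`, the two vectors are bounded by multiples of the positive and
negative parts of the single element `4ʲ xᵢ - xⱼ`, which are disjoint. -/
theorem exists_disjointification {x : ℕ → E} (hx : ∀ n, 0 ≤ x n) {C : ℝ} (hC : ∀ n, ‖x n‖ ≤ C) :
    ∃ s : E, 0 ≤ s ∧ ∀ i j : ℕ, i ≠ j →
      (x i - (4 : ℝ) ^ i • ∑ k ∈ Finset.range i, x k - (1 / 2 : ℝ) ^ i • s)⁺ ⊓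
      (x j - (4 : ℝ) ^ j • ∑ k ∈ Finset.range j, x k - (1 / 2 : ℝ) ^ j • s)⁺ = 0 := by
  have hsum : Summable fun n => (1 / 2 : ℝ) ^ n • x n := by
    refine Summable.of_norm_bounded (summable_geometric_two.mul_right C) fun n => ?_
    rw [norm_smul, norm_pow]
    norm_num
    exact hC n
  set s := ∑' n, (1 / 2 : ℝ) ^ n • x n with hs
  have hterm : ∀ n, 0 ≤ (1 / 2 : ℝ) ^ n • x n := fun n => smul_nonneg (by positivity) (hx n)
  have hle : ∀ n, (1 / 2 : ℝ) ^ n • x n ≤ s := fun n => hsum.le_tsum n fun j _ => hterm j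
  have hs0 : 0 ≤ s := (hterm 0).trans (hle 0)
  have key : ∀ i j : ℕ, i < j →
      (x i - (4 : ℝ) ^ i • ∑ k ∈ Finset.range i, x k - (1 / 2 : ℝ) ^ i • s)⁺ ⊓
      (x j - (4 : ℝ) ^ j • ∑ k ∈ Finset.range j, x k - (1 / 2 : ℝ) ^ j • s)⁺ = 0 := by
    intro i j hij
    have hSi : 0 ≤ (4 : ℝ) ^ i • ∑ k ∈ Finset.range i, x k :=
      smul_nonneg (by positivity) (Finset.sum_nonneg fun k _ => hx k)
    have hsj : 0 ≤ (1 / 2 : ℝ) ^ j • s := smul_nonneg (by positivity) hs0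
    have h1 : x j - (4 : ℝ) ^ j • ∑ k ∈ Finset.range j, x k - (1 / 2 : ℝ) ^ j • s ≤
        x j - (4 : ℝ) ^ j • x i := by
      refine (sub_le_self _ hsj).trans (sub_le_sub_left ?_ _)
      exact smul_le_smul_of_nonneg_left
        (Finset.single_le_sum (fun k _ => hx k) (Finset.mem_range.2 hij)) (by positivity)
    have h2 : x i - (4 : ℝ) ^ i • ∑ k ∈ Finset.range i, x k - (1 / 2 : ℝ) ^ i • s ≤
        (4⁻¹ : ℝ) ^ j • ((4 : ℝ) ^ j • x i - x j) := by
      rw [smul_sub, smul_smul, ← mul_pow]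
      norm_num only [one_pow, one_smul]
      -- The term `2⁻ⁱ s` pays for `4⁻ʲ xⱼ`, since `2⁻ʲ xⱼ ≤ s` and `2⁻ʲ ≤ 2⁻ⁱ`.
      have : (1 / 4 : ℝ) ^ j • x j ≤ (1 / 2 : ℝ) ^ i • s := by
        refine le_trans ?_ (smul_le_smul_of_nonneg_left (hle j) (by positivity))
        rw [smul_smul]
        refine smul_le_smul_of_nonneg_right ?_ (hx j)
        calc (1 / 4 : ℝ) ^ j = (1 / 2) ^ j * (1 / 2) ^ j := by rw [← mul_pow]; norm_num
          _ ≤ _ := by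
            refine mul_le_mul_of_nonneg_right ?_ (by positivity)
            exact pow_le_pow_of_le_one (by norm_num) (by norm_num) hij.le
      refine sub_le_sub ?_ this
      exact sub_le_self _ hSi
    have h4 : ((4 : ℝ) ^ j • x i - x j)⁺ ⊓ (x j - (4 : ℝ) ^ j • x i)⁺ = 0 :=
      posPart_sub_inf_posPart_sub _ _
    refine inf_eq_zero_of_le (posPart_nonneg _) (posPart_nonneg _) ((posPart_mono h2).trans ?_)
      (posPart_mono h1) h4
    dsimp only
    rw [← smul_posPart_of_pos (show (0 : ℝ) < 4⁻¹ ^ j by positivity)]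
    exact smul_le_of_le_one_left (posPart_nonneg _) (pow_le_one₀ (by norm_num) (by norm_num))
  refine ⟨s, hs0, fun i j hij => ?_⟩
  rcases lt_or_gt_of_ne hij with h | h
  · exact key i j h
  · rw [inf_comm]; exact key j i h

end Disjointification

/-! ### Positive decomposition of functionals by Hahn–Banach -/

section Decomposition

variable {V : Type*} [NormedAddCommGroup V] [NormedSpace ℝ V]

/-- The Grosberg-Krein theorem: if the norm of `V` is normal and generating for a cone, then every
functional is a difference of positive ones. -/
theorem exists_sub_of_normal_generating (K : ConvexCone ℝ V) (h0 : (0 : V) ∈ K)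
    (hgen : ∀ v : V, ∃ h ∈ K, h - v ∈ K ∧ ‖h‖ ≤ ‖v‖)
    (hnorm : ∀ v : V, ∀ a ∈ K, ∀ b ∈ K, a - v ∈ K → b + v ∈ K → ‖v‖ ≤ ‖a‖ + ‖b‖)
    (φ : StrongDual ℝ V) :
    ∃ φ₁ φ₂ : StrongDual ℝ V, (∀ v ∈ K, 0 ≤ φ₁ v) ∧ (∀ v ∈ K, 0 ≤ φ₂ v) ∧
      (∀ v, φ v = φ₁ v - φ₂ v) ∧ ‖φ₁‖ ≤ ‖φ‖ ∧ ‖φ₂‖ ≤ ‖φ‖ := by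
  -- `q v` is the least norm of a positive majorant of `v`: a sublinear functional vanishing on
  -- `-K`, so domination by `q` forces positivity.
  let A : V → Set ℝ := fun v => {r | ∃ h ∈ K, h - v ∈ K ∧ ‖h‖ = r}
  let q : V → ℝ := fun v => sInf (A v)
  have hAne : ∀ v, (A v).Nonempty := fun v => by
    obtain ⟨h, h1, h2, -⟩ := hgen v
    exact ⟨_, h, h1, h2, rfl⟩
  have hAbdd : ∀ v, BddBelow (A v) := fun v => ⟨0, by
    rintro r ⟨h, -, -, rfl⟩; exact norm_nonneg _⟩
  have hq0 : ∀ v, 0 ≤ q v := fun v => le_csInf (hAne v) (by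
    rintro r ⟨h, -, -, rfl⟩; exact norm_nonneg _)
  have hqle : ∀ v h, h ∈ K → h - v ∈ K → q v ≤ ‖h‖ := fun v h h1 h2 =>
    csInf_le (hAbdd v) ⟨h, h1, h2, rfl⟩
  have hqex : ∀ v, ∀ ε > 0, ∃ h ∈ K, h - v ∈ K ∧ ‖h‖ < q v + ε := by
    intro v ε hε
    obtain ⟨r, ⟨h, h1, h2, rfl⟩, h3⟩ := exists_lt_of_csInf_lt (hAne v) (lt_add_of_pos_right (q v) hε)
    exact ⟨h, h1, h2, h3⟩
  have hqadd : ∀ v w, q (v + w) ≤ q v + q w := by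
    intro v w
    refine le_of_forall_pos_le_add fun ε hε => ?_
    obtain ⟨h, h1, h2, h3⟩ := hqex v (ε / 2) (by positivity)
    obtain ⟨k, k1, k2, k3⟩ := hqex w (ε / 2) (by positivity)
    have := hqle (v + w) (h + k) (K.add_mem h1 k1)
      (by convert K.add_mem h2 k2 using 1; abel)
    linarith [norm_add_le h k]
  have hqsmul_le : ∀ c : ℝ, 0 < c → ∀ v, q (c • v) ≤ c * q v := by
    intro c hc v
    refine le_of_forall_pos_le_add fun ε hε => ?_
    obtain ⟨h, h1, h2, h3⟩ := hqex v (ε / c) (by positivity)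
    have := hqle (c • v) (c • h) (K.smul_mem hc h1) (by rw [← smul_sub]; exact K.smul_mem hc h2)
    rw [norm_smul, Real.norm_of_nonneg hc.le] at this
    calc _ ≤ c * ‖h‖ := this
      _ ≤ c * (q v + ε / c) := by gcongr
      _ = _ := by field_simp
  have hqsmul : ∀ c : ℝ, 0 < c → ∀ v, q (c • v) = c * q v := by
    intro c hc v
    refine le_antisymm (hqsmul_le c hc v) ?_
    have := hqsmul_le c⁻¹ (inv_pos.2 hc) (c • v)
    rw [smul_smul, inv_mul_cancel₀ hc.ne', one_smul] at this
    rwa [← le_inv_mul_iff₀ hc]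
  have hqnorm : ∀ v, q v ≤ ‖v‖ := fun v => by
    obtain ⟨h, h1, h2, h3⟩ := hgen v
    exact (hqle v h h1 h2).trans h3
  have hnq : ∀ v, ‖v‖ ≤ q v + q (-v) := by
    intro v
    refine le_of_forall_pos_le_add fun ε hε => ?_
    obtain ⟨h, h1, h2, h3⟩ := hqex v (ε / 2) (by positivity)
    obtain ⟨k, k1, k2, k3⟩ := hqex (-v) (ε / 2) (by positivity)
    have := hnorm v h h1 k k1 h2 (by simpa using k2)
    linarith
  have hqK : ∀ v ∈ K, q (-v) = 0 := fun v hv =>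
    le_antisymm (by simpa using hqle (-v) 0 h0 (by simpa using hv)) (hq0 _)
  have hqz : q 0 = 0 := by simpa using hqK 0 h0
  -- On the antidiagonal, `(v, -v) ↦ φ v` is dominated by `‖φ‖ (q v + q (-v))` by normality. The
  -- restrictions of a Hahn–Banach extension to the two axes are `φ₁` and `φ₂`.
  let W : Submodule ℝ (V × V) := LinearMap.range (LinearMap.id.prod (-LinearMap.id : V →ₗ[ℝ] V))
  let g₀ : V × V →ₗ.[ℝ] ℝ := ⟨W, φ.toLinearMap ∘ₗ LinearMap.fst ℝ V V ∘ₗ W.subtype⟩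
  obtain ⟨g, hg1, hg2⟩ := exists_extension_of_le_sublinear g₀
    (fun p => ‖φ‖ * (q p.1 + q p.2))
    (by
      intro c hc p
      simp only [Prod.smul_fst, Prod.smul_snd, hqsmul c hc]
      ring)
    (by
      intro p p'
      rw [← mul_add]
      refine mul_le_mul_of_nonneg_left ?_ (norm_nonneg _)
      have h1 := hqadd p.1 p'.1
      have h2 := hqadd p.2 p'.2
      simp only [Prod.fst_add, Prod.snd_add]
      linarith)
    (by
      rintro ⟨_, ⟨v, rfl⟩⟩
      change φ v ≤ ‖φ‖ * (q v + q (-v))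
      refine (le_abs_self _).trans ((φ.le_opNorm v).trans ?_)
      exact mul_le_mul_of_nonneg_left (hnq v) (norm_nonneg _))
  have hb1 : ∀ v, g (v, 0) ≤ ‖φ‖ * q v := fun v => by
    simpa [hqz] using hg2 (v, 0)
  have hb2 : ∀ v, g (0, v) ≤ ‖φ‖ * q v := fun v => by
    simpa [hqz] using hg2 (0, v)
  have hn1 : ∀ v, g (v, 0) ≤ ‖φ‖ * ‖v‖ := fun v =>
    (hb1 v).trans (mul_le_mul_of_nonneg_left (hqnorm v) (norm_nonneg _))
  have hn2 : ∀ v, g (0, v) ≤ ‖φ‖ * ‖v‖ := fun v =>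
    (hb2 v).trans (mul_le_mul_of_nonneg_left (hqnorm v) (norm_nonneg _))
  have hneg1 : ∀ v, g (-v, 0) = -g (v, 0) := fun v => by rw [← map_neg]; simp
  have hneg2 : ∀ v, g (0, -v) = -g (0, v) := fun v => by rw [← map_neg]; simp
  refine ⟨(g ∘ₗ LinearMap.inl ℝ V V).mkContinuous ‖φ‖ fun v => ?_,
    (g ∘ₗ LinearMap.inr ℝ V V).mkContinuous ‖φ‖ fun v => ?_, fun v hv => ?_, fun v hv => ?_,
    fun v => ?_, LinearMap.mkContinuous_norm_le _ (norm_nonneg _) _,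
    LinearMap.mkContinuous_norm_le _ (norm_nonneg _) _⟩
  · change |g (v, 0)| ≤ _
    refine abs_le'.2 ⟨hn1 v, ?_⟩
    rw [← hneg1, ← norm_neg v]; exact hn1 _
  · change |g (0, v)| ≤ _
    refine abs_le'.2 ⟨hn2 v, ?_⟩
    rw [← hneg2, ← norm_neg v]; exact hn2 _
  · change 0 ≤ g (v, 0)
    have := hb1 (-v)
    rw [hqK v hv, hneg1] at this
    linarith
  · change 0 ≤ g (0, v)
    have := hb2 (-v)
    rw [hqK v hv, hneg2] at this
    linarith
  · change φ v = g (v, 0) - g (0, v)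
    have h1 : g (v, -v) = φ v := hg1 ⟨(v, -v), ⟨v, rfl⟩⟩
    rw [← h1, sub_eq_add_neg, ← hneg2, ← map_add]
    simp

end Decomposition

/-! ### Band components of functionals and their weak convergence -/

section Dual

variable {F : Type*} [NormedAddCommGroup F] [NormedSpace ℝ F] [Lattice F]
    [IsOrderedAddMonoid F] [IsOrderedModule ℝ F] [HasSolidNorm F]

theorem le_of_nonneg_of_le {F : Type*} [NormedAddCommGroup F] [NormedSpace ℝ F] [PartialOrder F]
    [IsOrderedAddMonoid F] {f : StrongDual ℝ F} (hf : 0 ≤ f) {x y : F} (hxy : x ≤ y) :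
    f x ≤ f y := by
  have := hf (y - x) (sub_nonneg.2 hxy)
  rw [map_sub] at this
  simpa using this

theorem abs_apply_le_of_nonneg {F : Type*} [NormedAddCommGroup F] [NormedSpace ℝ F] [Lattice F]
    [IsOrderedAddMonoid F] {f : StrongDual ℝ F} (hf : 0 ≤ f) (x : F) :
    |f x| ≤ f |x| := by
  refine abs_le'.2 ⟨le_of_nonneg_of_le hf (le_abs_self x), ?_⟩
  rw [← map_neg]
  exact le_of_nonneg_of_le hf (neg_le_abs x)

/-- Every functional on a Banach lattice is a difference of positive ones. -/
theorem exists_eq_sub_of_nonneg (f : StrongDual ℝ F) :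
    ∃ f₁ f₂ : StrongDual ℝ F, 0 ≤ f₁ ∧ 0 ≤ f₂ ∧ f = f₁ - f₂ ∧ ‖f₁‖ ≤ ‖f‖ ∧ ‖f₂‖ ≤ ‖f‖ := by
  obtain ⟨f₁, f₂, h1, h2, h3, h4⟩ := exists_sub_of_normal_generating (ConvexCone.positive ℝ F)
    (le_refl (0 : F))
    (fun v => ⟨v⁺, posPart_nonneg v, sub_nonneg.2 (le_posPart v), norm_posPart_le v⟩)
    (fun v a ha b hb hav hbv => by
      refine (norm_le_norm_of_abs_le_abs (b := a + b) ?_).trans (norm_add_le a b)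
      have ha' : 0 ≤ a := ha
      have hb' : 0 ≤ b := hb
      have h1 : v ≤ a := sub_nonneg.1 hav
      have h2 : -v ≤ b := neg_le_iff_add_nonneg.2 hbv
      rw [abs_of_nonneg (add_nonneg ha' hb')]
      exact abs_le'.2 ⟨h1.trans (le_add_of_nonneg_right hb'), h2.trans (le_add_of_nonneg_left ha')⟩)
    f
  exact ⟨f₁, f₂, h1, h2, ContinuousLinearMap.ext h3, h4⟩

/-- The cone of positive functionals. -/
def dualCone (F : Type*) [NormedAddCommGroup F] [NormedSpace ℝ F] [Preorder F] :
    ConvexCone ℝ (StrongDual ℝ F) where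
  carrier := {f | 0 ≤ f}
  smul_mem' _ hc _ hf x hx := mul_nonneg hc.le (hf x hx)
  add_mem' _ hf _ hg x hx := add_nonneg (hf x hx) (hg x hx)

/-- Every functional on the dual of a Banach lattice is a difference of positive ones. -/
theorem exists_eq_sub_of_nonneg_bidual (φ : StrongDual ℝ (StrongDual ℝ F)) :
    ∃ φ₁ φ₂ : StrongDual ℝ (StrongDual ℝ F), 0 ≤ φ₁ ∧ 0 ≤ φ₂ ∧ φ = φ₁ - φ₂ := by
  obtain ⟨f₁, f₂, h1, h2, h3, h4⟩ := exists_sub_of_normal_generating (dualCone F)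
    (le_refl (0 : StrongDual ℝ F))
    (fun f => by
      obtain ⟨f₁, f₂, h1, h2, rfl, h4, h5⟩ := exists_eq_sub_of_nonneg f
      exact ⟨f₁, h1, show 0 ≤ f₁ - (f₁ - f₂) by rwa [sub_sub_cancel], h4⟩)
    (fun f a ha b hb hav hbv => by
      have ha' : 0 ≤ a := ha
      have hb' : 0 ≤ b := hb
      refine (ContinuousLinearMap.opNorm_le_bound f (norm_nonneg (a + b)) fun x => ?_).trans
        (norm_add_le a b)
      have hle : ∀ y, 0 ≤ y → |f y| ≤ (a + b) y := by
        intro y hy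
        have h1 : 0 ≤ a y - f y := hav y hy
        have h2 : 0 ≤ b y + f y := hbv y hy
        have h3 : 0 ≤ a y := ha' y hy
        have h4 : 0 ≤ b y := hb' y hy
        refine abs_le'.2 ⟨?_, ?_⟩ <;> simp only [add_apply] <;> linarith
      calc ‖f x‖ = |f x⁺ - f x⁻| := by rw [← map_sub, posPart_sub_negPart]; rfl
        _ ≤ |f x⁺| + |f x⁻| := abs_sub _ _
        _ ≤ (a + b) x⁺ + (a + b) x⁻ :=
          add_le_add (hle _ (posPart_nonneg x)) (hle _ (negPart_nonneg x))
        _ = (a + b) |x| := by rw [← map_add, posPart_add_negPart]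
        _ ≤ ‖a + b‖ * ‖|x|‖ := (le_abs_self _).trans ((a + b).le_opNorm _)
        _ = _ := by rw [norm_abs_eq_norm])
    φ
  exact ⟨f₁, f₂, h1, h2, ContinuousLinearMap.ext h3⟩

theorem exists_tendsto_inf_nsmul (f : StrongDual ℝ F) {w x : F} (hw : 0 ≤ w) :
    ∃ l, Tendsto (fun k : ℕ => f (x ⊓ k • w)) atTop (𝓝 l) := by
  have key : ∀ g : StrongDual ℝ F, 0 ≤ g →
      ∃ l, Tendsto (fun k : ℕ => g (x ⊓ k • w)) atTop (𝓝 l) := by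
    intro g hg
    refine ⟨_, tendsto_atTop_ciSup ?_ ⟨g x, ?_⟩⟩
    · intro k l hkl
      exact le_of_nonneg_of_le hg (inf_le_inf_left _ (nsmul_le_nsmul_left hw hkl))
    · rintro _ ⟨k, rfl⟩
      exact le_of_nonneg_of_le hg inf_le_left
  obtain ⟨f₁, f₂, h1, h2, rfl, -⟩ := exists_eq_sub_of_nonneg f
  obtain ⟨l₁, hl₁⟩ := key f₁ h1
  obtain ⟨l₂, hl₂⟩ := key f₂ h2
  exact ⟨_, hl₁.sub hl₂⟩

/-- The limit of `f (x ⊓ k • w)` as `k → ∞`. -/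
noncomputable def truncLim (f : StrongDual ℝ F) (w x : F) : ℝ :=
  limUnder atTop fun k : ℕ => f (x ⊓ k • w)

theorem tendsto_truncLim (f : StrongDual ℝ F) {w : F} (hw : 0 ≤ w) (x : F) :
    Tendsto (fun k : ℕ => f (x ⊓ k • w)) atTop (𝓝 (truncLim f w x)) :=
  tendsto_nhds_limUnder (exists_tendsto_inf_nsmul f hw)

theorem truncLim_add_left (f g : StrongDual ℝ F) {w : F} (hw : 0 ≤ w) (x : F) :
    truncLim (f + g) w x = truncLim f w x + truncLim g w x :=
  tendsto_nhds_unique (tendsto_truncLim (f + g) hw x)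
    ((tendsto_truncLim f hw x).add (tendsto_truncLim g hw x))

theorem truncLim_smul_left (c : ℝ) (f : StrongDual ℝ F) {w : F} (hw : 0 ≤ w) (x : F) :
    truncLim (c • f) w x = c * truncLim f w x :=
  tendsto_nhds_unique (tendsto_truncLim (c • f) hw x) ((tendsto_truncLim f hw x).const_mul c)

theorem truncLim_sub_left (f g : StrongDual ℝ F) {w : F} (hw : 0 ≤ w) (x : F) :
    truncLim (f - g) w x = truncLim f w x - truncLim g w x :=
  tendsto_nhds_unique (tendsto_truncLim (f - g) hw x)
    ((tendsto_truncLim f hw x).sub (tendsto_truncLim g hw x))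

theorem truncLim_add_right (f : StrongDual ℝ F) {w x y : F} (hw : 0 ≤ w) (hx : 0 ≤ x)
    (hy : 0 ≤ y) : truncLim f w (x + y) = truncLim f w x + truncLim f w y := by
  have key : ∀ g : StrongDual ℝ F, 0 ≤ g →
      truncLim g w (x + y) = truncLim g w x + truncLim g w y := by
    intro g hg
    have hk : ∀ k : ℕ, 0 ≤ k • w := fun k => nsmul_nonneg hw k
    apply le_antisymm
    · refine le_of_tendsto_of_tendsto' (tendsto_truncLim g hw (x + y))
        ((tendsto_truncLim g hw x).add (tendsto_truncLim g hw y)) fun k => ?_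
      rw [← map_add]
      refine le_of_nonneg_of_le hg ?_
      rw [inf_comm, inf_comm x, inf_comm y]
      exact inf_add_le_inf_add_inf (hk k) hx hy
    · have h2 : Tendsto (fun k : ℕ => k + k) atTop atTop :=
        tendsto_atTop_mono (fun k => Nat.le_add_left k k) tendsto_id
      refine le_of_tendsto_of_tendsto' ((tendsto_truncLim g hw x).add (tendsto_truncLim g hw y))
        ((tendsto_truncLim g hw (x + y)).comp h2) fun k => ?_
      rw [← map_add]
      refine le_of_nonneg_of_le hg ?_
      rw [add_nsmul]
      exact le_inf (add_le_add inf_le_left inf_le_left) (add_le_add inf_le_right inf_le_right)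
  obtain ⟨f₁, f₂, h1, h2, rfl, -⟩ := exists_eq_sub_of_nonneg f
  rw [truncLim_sub_left _ _ hw, truncLim_sub_left _ _ hw, truncLim_sub_left _ _ hw, key f₁ h1,
    key f₂ h2]
  ring

theorem abs_truncLim_le (f : StrongDual ℝ F) {w x : F} (hw : 0 ≤ w) (hx : 0 ≤ x) :
    |truncLim f w x| ≤ ‖f‖ * ‖x‖ := by
  refine le_of_tendsto' (tendsto_truncLim f hw x).abs fun k => (f.le_opNorm _).trans ?_
  refine mul_le_mul_of_nonneg_left ?_ (norm_nonneg _)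
  exact norm_le_norm_of_nonneg_of_le (le_inf hx (nsmul_nonneg hw k)) inf_le_left

theorem abs_truncLim_sub_le (f : StrongDual ℝ F) {w : F} (hw : 0 ≤ w) (x : F) :
    |truncLim f w x⁺ - truncLim f w x⁻| ≤ 2 * ‖f‖ * ‖x‖ := by
  refine (abs_sub _ _).trans ?_
  have h1 := abs_truncLim_le f hw (posPart_nonneg x)
  have h2 := abs_truncLim_le f hw (negPart_nonneg x)
  have h3 := mul_le_mul_of_nonneg_left (norm_posPart_le x) (norm_nonneg f)
  have h4 := mul_le_mul_of_nonneg_left (norm_negPart_le x) (norm_nonneg f)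
  linarith

theorem truncLim_posPart_sub_add (f : StrongDual ℝ F) {w : F} (hw : 0 ≤ w) (x y : F) :
    truncLim f w (x + y)⁺ - truncLim f w (x + y)⁻ =
      (truncLim f w x⁺ - truncLim f w x⁻) + (truncLim f w y⁺ - truncLim f w y⁻) := by
  have h : (x + y)⁺ + (x⁻ + y⁻) = (x + y)⁻ + (x⁺ + y⁺) := by
    have e : (x + y)⁺ - (x + y)⁻ = (x⁺ - x⁻) + (y⁺ - y⁻) := by simp only [posPart_sub_negPart]
    rw [sub_eq_iff_eq_add] at e
    rw [e]; abel
  have := congrArg (truncLim f w) h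
  rw [truncLim_add_right f hw, truncLim_add_right f hw, truncLim_add_right f hw,
    truncLim_add_right f hw] at this
  · linarith
  all_goals first | exact posPart_nonneg _ | exact negPart_nonneg _ |
    exact add_nonneg (posPart_nonneg _) (posPart_nonneg _)

/-- The functional `x ↦ lim f (x ⊓ k • w)` (for `x ≥ 0`), the component of `f` carried by `w`. -/
noncomputable def bandFunctional {w : F} (hw : 0 ≤ w) (f : StrongDual ℝ F) : StrongDual ℝ F :=
  AddMonoidHom.toRealLinearMap
    (AddMonoidHom.mk' (fun x => truncLim f w x⁺ - truncLim f w x⁻)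
      (truncLim_posPart_sub_add f hw))
    (AddMonoidHomClass.continuous_of_bound _ (2 * ‖f‖) (abs_truncLim_sub_le f hw))

theorem bandFunctional_apply {w : F} (hw : 0 ≤ w) (f : StrongDual ℝ F) (x : F) :
    bandFunctional hw f x = truncLim f w x⁺ - truncLim f w x⁻ := rfl

theorem tendsto_bandFunctional {w : F} (hw : 0 ≤ w) (f : StrongDual ℝ F) {x : F} (hx : 0 ≤ x) :
    Tendsto (fun k : ℕ => f (x ⊓ k • w)) atTop (𝓝 (bandFunctional hw f x)) := by
  have h0 : truncLim f w 0 = 0 := abs_nonpos_iff.1 (by simpa using abs_truncLim_le f hw le_rfl)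
  rw [bandFunctional_apply, posPart_of_nonneg hx, negPart_of_nonneg hx, h0, sub_zero]
  exact tendsto_truncLim f hw x

/-- The projection of the dual of a Banach lattice onto the functionals carried by `w`. -/
noncomputable def bandOperator {w : F} (hw : 0 ≤ w) : StrongDual ℝ F →L[ℝ] StrongDual ℝ F :=
  LinearMap.mkContinuous
    { toFun := bandFunctional hw
      map_add' := fun f g => by
        ext x
        simp only [bandFunctional_apply, add_apply,
          truncLim_add_left _ _ hw]
        ring
      map_smul' := fun c f => by
        ext x
        simp only [bandFunctional_apply, smul_apply,
          truncLim_smul_left _ _ hw, smul_eq_mul, RingHom.id_apply]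
        ring }
    2 fun f => ContinuousLinearMap.opNorm_le_bound _ (by positivity) (abs_truncLim_sub_le f hw)

theorem tendsto_bandOperator {w : F} (hw : 0 ≤ w) (f : StrongDual ℝ F) {x : F} (hx : 0 ≤ x) :
    Tendsto (fun k : ℕ => f (x ⊓ k • w)) atTop (𝓝 (bandOperator hw f x)) :=
  tendsto_bandFunctional hw f hx

theorem bandOperator_nonneg {w : F} (hw : 0 ≤ w) {f : StrongDual ℝ F} (hf : 0 ≤ f) :
    0 ≤ bandOperator hw f := fun _ hx =>
  ge_of_tendsto' (tendsto_bandOperator hw f hx) fun k =>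
    hf _ (le_inf hx (nsmul_nonneg hw k))

/-- The elements `x ⊓ k • w n` are disjoint in `n` and below `x`, hence so is their sum; apply `f`
and let `k → ∞`. -/
theorem sum_bandOperator_le {w : ℕ → F} (hw : ∀ n, 0 ≤ w n) (hd : ∀ m n, m ≠ n → w m ⊓ w n = 0)
    {f : StrongDual ℝ F} (hf : 0 ≤ f) (s : Finset ℕ) :
    ∑ n ∈ s, bandOperator (hw n) f ≤ f := by
  intro x hx
  rw [sum_apply]
  refine le_of_tendsto' (tendsto_finsetSum s fun n _ => tendsto_bandOperator (hw n) f hx)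
    fun k => ?_
  rw [← map_sum]
  have hk : ∀ n, 0 ≤ k • w n := fun n => nsmul_nonneg (hw n) k
  refine le_of_nonneg_of_le hf (sum_le_of_pairwise_inf_eq_zero (fun n => le_inf hx (hk n))
    (fun m n hmn => ?_) hx (fun n => inf_le_left) s)
  refine inf_eq_zero_of_le (le_inf hx (hk m)) (le_inf hx (hk n)) inf_le_right inf_le_right ?_
  refine inf_nsmul_eq_zero (hk m) (hw n) ?_ k
  rw [inf_comm]
  exact inf_nsmul_eq_zero (hw n) (hw m) (hd n m hmn.symm) k

/-- If the bidual has order continuous norm, the components of a bounded sequence of positive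
functionals along a disjoint sequence are weakly null. -/
theorem tendsto_apply_bandOperator
    (hF : HasOrderContinuousNorm (StrongDual ℝ (StrongDual ℝ F)))
    {w : ℕ → F} (hw : ∀ n, 0 ≤ w n) (hd : ∀ m n, m ≠ n → w m ⊓ w n = 0)
    {h : ℕ → StrongDual ℝ F} {C : ℝ} (hC : ∀ n, ‖h n‖ ≤ C)
    (φ : StrongDual ℝ (StrongDual ℝ F)) :
    Tendsto (fun n => φ (bandOperator (hw n) (h n))) atTop (𝓝 0) := by
  have key : ∀ ψ : StrongDual ℝ (StrongDual ℝ F), 0 ≤ ψ →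
      Tendsto (fun n => ψ (bandOperator (hw n) (h n))) atTop (𝓝 0) := by
    intro ψ hψ
    have hψ' : ∀ f g : StrongDual ℝ F, f ≤ g → ψ f ≤ ψ g := fun f g hfg => by
      have := hψ (g - f) fun x hx => by simpa using hfg x hx
      rw [map_sub] at this
      simpa using this
    let c : ℕ → StrongDual ℝ (StrongDual ℝ F) := fun n => ψ ∘L bandOperator (hw n)
    have hc0 : ∀ n f, 0 ≤ f → 0 ≤ c n f := fun n f hf => hψ _ (bandOperator_nonneg (hw n) hf)
    have hcs : ∀ f, 0 ≤ f → ∀ s : Finset ℕ, ∑ n ∈ s, c n f ≤ ψ f := fun f hf s => by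
      have := hψ' _ _ (sum_bandOperator_le hw hd hf s)
      rwa [map_sum] at this
    have hsummable : ∀ f, Summable fun n => c n f := by
      intro f
      have hp : ∀ f, 0 ≤ f → Summable fun n => c n f := fun f hf =>
        summable_of_sum_le (hc0 · f hf) (hcs f hf)
      obtain ⟨f₁, f₂, h1, h2, rfl, -⟩ := exists_eq_sub_of_nonneg f
      simpa using (hp f₁ h1).sub (hp f₂ h2)
    let S : ℕ → StrongDual ℝ (StrongDual ℝ F) := fun N => ∑ n ∈ Finset.range N, c n
    have hS : Tendsto (fun N f => S N f) atTop (𝓝 fun f => ∑' n, c n f) := by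
      refine tendsto_pi_nhds.2 fun f => ?_
      simpa [S] using (hsummable f).hasSum.tendsto_sum_nat
    -- The pointwise limit is continuous by Banach–Steinhaus.
    let S' : StrongDual ℝ (StrongDual ℝ F) := continuousLinearMapOfTendsto (σ₁₂ := RingHom.id ℝ) S hS
    have hS' : ∀ f, Tendsto (fun N => S N f) atTop (𝓝 (S' f)) := fun f => tendsto_pi_nhds.1 hS f
    have hmono : ∀ f, 0 ≤ f → Monotone fun N => S N f := fun f hf =>
      monotone_nat_of_le_succ fun N => by
        simp only [S, Finset.sum_range_succ, add_apply]
        linarith [hc0 N f hf]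
    -- `S' - S N` decreases to 0; `ULift` moves the index set to the universe of the bidual.
    have hlim := hF (ULift ℕ) (fun N => S' - S N.down)
      (fun M N hMN f hf => by
        exact sub_le_sub_left (hmono f hf hMN) (S' f))
      ⟨by
        rintro _ ⟨N, rfl⟩ f hf
        simpa using (hmono f hf).ge_of_tendsto (hS' f) N.down, by
        intro χ hχ f hf
        have h1 : Tendsto (fun N => S' f - S N f) atTop (𝓝 (S' f - S' f)) :=
          tendsto_const_nhds.sub (hS' f)
        rw [sub_self] at h1
        exact ge_of_tendsto' h1 fun N => hχ ⟨⟨N⟩, rfl⟩ f hf⟩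
    have hlim' : Tendsto (fun N : ℕ => ‖S' - S N‖) atTop (𝓝 0) :=
      hlim.comp (f := ULift.up) (tendsto_atTop.2 fun b => eventually_ge_atTop b.down)
    have hbound : Tendsto (fun N => (‖S' - S N‖ + ‖S' - S (N + 1)‖) * C) atTop (𝓝 0) := by
      simpa using (hlim'.add (hlim'.comp (tendsto_add_atTop_nat 1))).mul_const C
    refine squeeze_zero_norm (fun N => ?_) hbound
    have e : ψ (bandOperator (hw N) (h N)) = ((S' - S N) - (S' - S (N + 1))) (h N) := by
      simp [S, Finset.sum_range_succ, c]
    rw [e]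
    refine (ContinuousLinearMap.le_opNorm _ _).trans ?_
    exact mul_le_mul (norm_sub_le _ _) (hC N) (norm_nonneg _) (by positivity)
  obtain ⟨φ₁, φ₂, h1, h2, rfl⟩ := exists_eq_sub_of_nonneg_bidual φ
  simpa using (key φ₁ h1).sub (key φ₂ h2)

end Dual

/-! ### From disjoint sequences to all bounded sequences -/

section Semicompact

variable {E : Type*} [NormedAddCommGroup E] [NormedSpace ℝ E] [CompleteSpace E] [Lattice E]
    [IsOrderedAddMonoid E] [IsOrderedModule ℝ E] [HasSolidNorm E]
    {F : Type*} [NormedAddCommGroup F] [NormedSpace ℝ F] [Lattice F]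
    [IsOrderedAddMonoid F]

theorem isWeaklyConvergent_zero {X : Type*} [NormedAddCommGroup X] [NormedSpace ℝ X] {x : ℕ → X}
    (h : ∀ φ : StrongDual ℝ X, Tendsto (fun n => φ (x n)) atTop (𝓝 0)) : IsWeaklyConvergent x := by
  refine ⟨0, ?_⟩
  have hind : IsInducing fun (y : WeakSpace ℝ X) (φ : StrongDual ℝ X) =>
    (topDualPairing ℝ X).flip y φ := ⟨rfl⟩
  rw [hind.tendsto_nhds_iff, tendsto_pi_nhds]
  intro φ
  refine Tendsto.congr (fun n => ?_) ((h φ).trans_eq ?_)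
  · rfl
  · exact congrArg 𝓝 (map_zero φ).symm

/-- An order bounded, almost M-weakly compact operator satisfies `f n (T (p n)) → 0` for
bounded positive `p n` and weakly null positive `f n`, along a subsequence. -/
theorem exists_subseq_tendsto_apply {T : E →L[ℝ] F} (hT_bdd : IsOrderBounded T)
    (hT : IsAlmostMWeaklyCompact T) {f : ℕ → StrongDual ℝ F} (hf : ∀ n, 0 ≤ f n)
    (hf0 : ∀ φ : StrongDual ℝ (StrongDual ℝ F), Tendsto (fun n => φ (f n)) atTop (𝓝 0))
    {C : ℝ} (hC : ∀ n, ‖f n‖ ≤ C) {p : ℕ → E} (hp : ∀ n, 0 ≤ p n) (hp1 : ∀ n, ‖p n‖ ≤ 1) :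
    ∃ m : ℕ → ℕ, Tendsto (fun k => f (m k) (T (p (m k)))) atTop (𝓝 0) := by
  have hC0 : 0 ≤ C := (norm_nonneg _).trans (hC 0)
  let X : ℕ → E := fun N => (4 : ℝ) ^ N • ∑ i ∈ Finset.range N, p i
  have hz : ∀ N, ∃ z : F, ∀ y ∈ Icc 0 (X N), |T y| ≤ z := by
    intro N
    obtain ⟨c, d, hcd⟩ := hT_bdd 0 (X N)
    refine ⟨|c| ⊔ |d|, fun y hy => ?_⟩
    have := hcd ⟨y, hy, rfl⟩
    refine abs_le'.2 ⟨this.2.trans ((le_abs_self d).trans le_sup_right), ?_⟩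
    exact (neg_le_neg this.1).trans ((neg_le_abs c).trans le_sup_left)
  choose z hz using hz
  -- Weak nullity makes a later functional small on the fixed bound `z (N + 1)`. The shift by one is
  -- needed because `X (N + 1)` includes `p N`, the last vector already chosen.
  have hsmall : ∀ N, ∃ M, N < M ∧ f M (z (N + 1)) < (1 / 2 : ℝ) ^ N := by
    intro N
    have h1 := hf0 (NormedSpace.inclusionInDoubleDual ℝ F (z (N + 1)))
    have h2 := (h1.eventually_lt_const (show (0 : ℝ) < (1 / 2) ^ N by positivity)).and
      (eventually_gt_atTop N)
    obtain ⟨M, h3, h4⟩ := h2.exists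
    exact ⟨M, h4, h3⟩
  choose g hg1 hg2 using hsmall
  let m : ℕ → ℕ := fun k => g^[k] 0
  have hm_succ : ∀ k, m (k + 1) = g (m k) := fun k => Function.iterate_succ_apply' g k 0
  have hm : StrictMono m := strictMono_nat_of_lt_succ fun k => by rw [hm_succ]; exact hg1 _
  have hXle : ∀ k, (4 : ℝ) ^ (k + 1) • ∑ i ∈ Finset.range (k + 1), p (m i) ≤ X (m k + 1) := by
    intro k
    have h1 : ∑ i ∈ Finset.range (k + 1), p (m i) ≤ ∑ i ∈ Finset.range (m k + 1), p i := by
      rw [← Finset.sum_image (f := p) (g := m) (hm.injective.injOn)]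
      refine Finset.sum_le_sum_of_subset_of_nonneg ?_ fun i _ _ => hp i
      intro j hj
      obtain ⟨i, hi, rfl⟩ := Finset.mem_image.1 hj
      have := hm.monotone (Nat.lt_succ_iff.1 (Finset.mem_range.1 hi))
      exact Finset.mem_range.2 (Nat.lt_succ_iff.2 this)
    have h2 : (4 : ℝ) ^ (k + 1) ≤ 4 ^ (m k + 1) :=
      pow_le_pow_right₀ (by norm_num) (Nat.succ_le_succ (hm.id_le k))
    exact (smul_le_smul_of_nonneg_left h1 (by positivity)).trans
      (smul_le_smul_of_nonneg_right h2 (Finset.sum_nonneg fun i _ => hp i))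
  obtain ⟨s, hs, hdisj⟩ := exists_disjointification (x := fun k => p (m k)) (fun k => hp _)
    (fun k => hp1 _)
  let q : ℕ → E := fun k => (4 : ℝ) ^ k • ∑ i ∈ Finset.range k, p (m i)
  let r : ℕ → E := fun k => (1 / 2 : ℝ) ^ k • s
  let v : ℕ → E := fun k => (p (m k) - q k - r k)⁺
  have hq : ∀ k, 0 ≤ q k := fun k =>
    smul_nonneg (by positivity) (Finset.sum_nonneg fun i _ => hp _)
  have hr : ∀ k, 0 ≤ r k := fun k => smul_nonneg (by positivity) hs
  have hv0 : ∀ k, 0 ≤ v k := fun k => posPart_nonneg _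
  have hv1 : ∀ k, v k ≤ p (m k) := fun k =>
    sup_le ((sub_le_self _ (hr k)).trans (sub_le_self _ (hq k))) (hp _)
  have htv : Tendsto (fun k => f (m k) (T (v k))) atTop (𝓝 0) := by
    refine hT v (fun i j hij => ?_) (fun k => ?_) _ (isWeaklyConvergent_zero fun φ =>
      (hf0 φ).comp hm.tendsto_atTop)
    · rw [abs_of_nonneg (hv0 i), abs_of_nonneg (hv0 j)]
      exact hdisj i j hij
    · rw [mem_closedBall_zero_iff]
      exact (norm_le_norm_of_nonneg_of_le (hv0 k) (hv1 k)).trans (hp1 _)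
  -- Split `P - v` as `P ⊓ Q` plus `(P - Q)⁺ - v`: the first lies in the interval controlled by `z`,
  -- the second is at most `r` and so small in norm.
  have hdiff : ∀ k, |f (m (k + 1)) (T (p (m (k + 1)))) - f (m (k + 1)) (T (v (k + 1)))| ≤
      (1 / 2 : ℝ) ^ k + C * ‖T‖ * ((1 / 2 : ℝ) ^ (k + 1) * ‖s‖) := by
    intro k
    set P := p (m (k + 1))
    set Q := q (k + 1)
    have h1 : P - (P - Q)⁺ ∈ Icc 0 (X (m k + 1)) := by
      rw [sub_posPart_sub]
      exact ⟨le_inf (hp _) (hq _), inf_le_right.trans (hXle k)⟩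
    have h2 : |f (m (k + 1)) (T (P - (P - Q)⁺))| ≤ (1 / 2 : ℝ) ^ k := by
      refine (abs_apply_le_of_nonneg (hf _) _).trans
        ((le_of_nonneg_of_le (hf _) (hz _ _ h1)).trans ?_)
      rw [hm_succ]
      refine (hg2 (m k)).le.trans ?_
      exact pow_le_pow_of_le_one (by norm_num) (by norm_num) (hm.id_le k)
    have h3 : ‖(P - Q)⁺ - v (k + 1)‖ ≤ (1 / 2 : ℝ) ^ (k + 1) * ‖s‖ := by
      have h4 : 0 ≤ (P - Q)⁺ - v (k + 1) :=
        sub_nonneg.2 (posPart_mono (sub_le_self _ (hr _)))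
      refine (norm_le_norm_of_nonneg_of_le h4
        (sub_le_iff_le_add'.2 (posPart_sub_le_add (hr (k + 1))))).trans ?_
      rw [norm_smul, norm_pow]
      norm_num
    have h5 : |f (m (k + 1)) (T ((P - Q)⁺ - v (k + 1)))| ≤
        C * ‖T‖ * ((1 / 2 : ℝ) ^ (k + 1) * ‖s‖) := by
      refine ((f _).le_opNorm _).trans ?_
      rw [mul_assoc]
      exact mul_le_mul (hC _) ((T.le_opNorm _).trans
        (mul_le_mul_of_nonneg_left h3 (norm_nonneg _))) (norm_nonneg _) hC0
    have e : f (m (k + 1)) (T P) - f (m (k + 1)) (T (v (k + 1))) =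
        f (m (k + 1)) (T (P - (P - Q)⁺)) + f (m (k + 1)) (T ((P - Q)⁺ - v (k + 1))) := by
      rw [← map_sub, ← map_sub, ← map_add, ← map_add]
      congr 2; abel
    rw [e]
    exact (abs_add_le _ _).trans (add_le_add h2 h5)
  refine ⟨fun k => m (k + 1), ?_⟩
  have hpow : Tendsto (fun k : ℕ => (1 / 2 : ℝ) ^ k) atTop (𝓝 0) :=
    tendsto_pow_atTop_nhds_zero_of_lt_one (by norm_num) (by norm_num)
  have hb : Tendsto (fun k : ℕ => (1 / 2 : ℝ) ^ k + C * ‖T‖ * ((1 / 2 : ℝ) ^ (k + 1) * ‖s‖))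
      atTop (𝓝 0) := by
    simpa using hpow.add (((hpow.comp (tendsto_add_atTop_nat 1)).mul_const ‖s‖).const_mul (C * ‖T‖))
  simpa using (squeeze_zero_norm hdiff hb).add (htv.comp (tendsto_add_atTop_nat 1))

theorem tendsto_apply_of_weakly_null {T : E →L[ℝ] F} (hT_bdd : IsOrderBounded T)
    (hT : IsAlmostMWeaklyCompact T) {f : ℕ → StrongDual ℝ F} (hf : ∀ n, 0 ≤ f n)
    (hf0 : ∀ φ : StrongDual ℝ (StrongDual ℝ F), Tendsto (fun n => φ (f n)) atTop (𝓝 0))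
    {C : ℝ} (hC : ∀ n, ‖f n‖ ≤ C) {x : ℕ → E} (hx : ∀ n, ‖x n‖ ≤ 1) :
    Tendsto (fun n => f n (T (x n))) atTop (𝓝 0) := by
  have key : ∀ p : ℕ → E, (∀ n, 0 ≤ p n) → (∀ n, ‖p n‖ ≤ 1) →
      Tendsto (fun n => f n (T (p n))) atTop (𝓝 0) := fun p hp hp1 =>
    tendsto_of_subseq_tendsto fun ns hns =>
      exists_subseq_tendsto_apply hT_bdd hT (f := fun n => f (ns n)) (fun n => hf _)
        (fun φ => (hf0 φ).comp hns) (fun n => hC _) (p := fun n => p (ns n)) (fun n => hp _)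
        (fun n => hp1 _)
  have h1 := key (fun n => (x n)⁺) (fun n => posPart_nonneg _)
    fun n => (norm_posPart_le _).trans (hx n)
  have h2 := key (fun n => (x n)⁻) (fun n => negPart_nonneg _)
    fun n => (norm_negPart_le _).trans (hx n)
  have h := h1.sub h2
  rw [sub_zero] at h
  refine h.congr fun n => ?_
  rw [← map_sub, ← map_sub, posPart_sub_negPart]

end Semicompact

/-! ### Norming functionals and the distance to an order interval -/

section NormingFunctional

variable {F : Type*} [NormedAddCommGroup F] [NormedSpace ℝ F] [Lattice F]
    [IsOrderedAddMonoid F] [IsOrderedModule ℝ F] [HasSolidNorm F]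

theorem exists_nonneg_norming {w : F} (hw : 0 ≤ w) :
    ∃ h : StrongDual ℝ F, 0 ≤ h ∧ ‖h‖ ≤ 1 ∧ ‖w‖ ≤ h w := by
  obtain ⟨f, hf1, hf2⟩ := exists_dual_vector'' ℝ w
  obtain ⟨f₁, f₂, h1, h2, rfl, h3, -⟩ := exists_eq_sub_of_nonneg f
  refine ⟨f₁, h1, h3.trans hf1, ?_⟩
  have h4 : 0 ≤ f₂ w := h2 w hw
  have h5 : f₁ w - f₂ w = ‖w‖ := hf2
  linarith

/-- The component ignores `y⁻`, which is disjoint from `w`, while `y⁺ ⊓ k • w ≥ w` as soon as `k ≥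
1`. -/
theorem le_bandOperator_apply {w y : F} (hw : 0 ≤ w) (hwy : w ≤ y⁺) {h : StrongDual ℝ F}
    (hh : 0 ≤ h) : h w ≤ bandOperator hw h y := by
  have h1 : h w ≤ bandOperator hw h y⁺ := by
    refine ge_of_tendsto (tendsto_bandOperator hw h (posPart_nonneg y)) ?_
    filter_upwards [eventually_ge_atTop 1] with k hk
    exact le_of_nonneg_of_le hh (le_inf hwy (by simpa using nsmul_le_nsmul_left hw hk))
  have h2 : bandOperator hw h y⁻ = 0 := by
    refine tendsto_nhds_unique (tendsto_bandOperator hw h (negPart_nonneg y)) ?_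
    have h3 : y⁻ ⊓ w = 0 := inf_eq_zero_of_le (negPart_nonneg y) hw le_rfl hwy
      (by rw [inf_comm]; exact posPart_inf_negPart_eq_zero y)
    simp [inf_nsmul_eq_zero (negPart_nonneg y) hw h3]
  calc h w ≤ bandOperator hw h y⁺ - bandOperator hw h y⁻ := by rwa [h2, sub_zero]
    _ = bandOperator hw h y := by rw [← map_sub, posPart_sub_negPart]

theorem mem_Icc_add_smul_closedBall {F : Type*} [NormedAddCommGroup F] [NormedSpace ℝ F]
    [Lattice F] [IsOrderedAddMonoid F] {u y : F} {ε : ℝ} (hε : 0 < ε) (hu : 0 ≤ u)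
    (h1 : ‖(y - u)⁺‖ ≤ ε / 2) (h2 : ‖(-y - u)⁺‖ ≤ ε / 2) :
    y ∈ Icc (-u) u + ε • Metric.closedBall (0 : F) 1 := by
  refine ⟨y - ((y - u)⁺ - (-y - u)⁺), ⟨?_, ?_⟩, (y - u)⁺ - (-y - u)⁺, ?_, by simp⟩
  · have := sub_posPart_add_posPart_le (y := -y) hu
    rw [neg_neg] at this
    rw [neg_le]
    convert this using 1
    abel
  · convert sub_posPart_add_posPart_le (y := y) hu using 1
    abel
  · rw [smul_closedBall _ _ zero_le_one, smul_zero, mem_closedBall_zero_iff, mul_one,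
      Real.norm_of_nonneg hε.le]
    linarith [norm_sub_le (y - u)⁺ (-y - u)⁺]

end NormingFunctional

end BanachLattice

/-! ### The contradiction argument -/

theorem theorem5
    {E : Type*} [NormedAddCommGroup E] [NormedSpace ℝ E] [CompleteSpace E] [Lattice E]
    [IsOrderedAddMonoid E] [IsOrderedModule ℝ E] [HasSolidNorm E]
    {F : Type*} [NormedAddCommGroup F] [NormedSpace ℝ F] [CompleteSpace F] [Lattice F]
    [IsOrderedAddMonoid F] [IsOrderedModule ℝ F] [HasSolidNorm F]
    (T : E →L[ℝ] F)
    (hT_bdd : BanachLattice.IsOrderBounded T)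
    (hT : BanachLattice.IsAlmostMWeaklyCompact T)
    (hF : BanachLattice.HasOrderContinuousNorm (StrongDual ℝ (StrongDual ℝ F))) :
    BanachLattice.IsSemicompact T := by
  open BanachLattice in
  intro ε hε
  by_contra! hcon
  have hex : ∀ u : F, 0 ≤ u → ∃ x : E, ‖x‖ ≤ 1 ∧ ε / 2 < ‖(T x - u)⁺‖ := by
    intro u hu
    by_contra! hle
    refine hcon u hu ?_
    rintro _ ⟨x, hx, rfl⟩
    rw [mem_closedBall_zero_iff] at hx
    refine mem_Icc_add_smul_closedBall hε hu (hle x hx) ?_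
    -- Symmetry of the ball supplies the other one-sided excess; the two halves of ε add up.
    simpa using hle (-x) (by simpa using hx)
  choose! c hc1 hc2 using hex
  -- Recursing on the partial sums instead of on `x` keeps the recursion one-step.
  let U : ℕ → F := fun n => Nat.rec 0 (fun k s => s + (T (c ((4 : ℝ) ^ k • s)))⁺) n
  let x : ℕ → E := fun n => c ((4 : ℝ) ^ n • U n)
  have hU : ∀ n, U n = ∑ i ∈ Finset.range n, (T (x i))⁺ := by
    intro n
    induction n with
    | zero => rfl
    | succ n ih => rw [Finset.sum_range_succ, ← ih]
  have hU0 : ∀ n, 0 ≤ (4 : ℝ) ^ n • U n := fun n => by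
    rw [hU]
    exact smul_nonneg (by positivity) (Finset.sum_nonneg fun i _ => posPart_nonneg _)
  have hx1 : ∀ n, ‖x n‖ ≤ 1 := fun n => hc1 _ (hU0 n)
  have hx2 : ∀ n, ε / 2 < ‖(T (x n) - (4 : ℝ) ^ n • U n)⁺‖ := fun n => hc2 _ (hU0 n)
  obtain ⟨s, hs, hd⟩ := exists_disjointification (x := fun n => (T (x n))⁺)
    (fun n => posPart_nonneg _) (C := ‖T‖) (fun n => (norm_posPart_le _).trans (by
      simpa using T.le_of_opNorm_le_of_le le_rfl (hx1 n)))
  simp only [← hU] at hd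
  let w : ℕ → F := fun n => ((T (x n))⁺ - (4 : ℝ) ^ n • U n - (1 / 2 : ℝ) ^ n • s)⁺
  have hr : ∀ n, 0 ≤ (1 / 2 : ℝ) ^ n • s := fun n => smul_nonneg (by positivity) hs
  have hw : ∀ n, 0 ≤ w n := fun n => posPart_nonneg _
  have hwle : ∀ n, w n ≤ (T (x n))⁺ := fun n =>
    sup_le ((sub_le_self _ (hr n)).trans (sub_le_self _ (hU0 n))) (posPart_nonneg _)
  have hwnorm : ∀ n, ε / 2 - (1 / 2 : ℝ) ^ n * ‖s‖ ≤ ‖w n‖ := by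
    intro n
    have h1 : (T (x n) - (4 : ℝ) ^ n • U n)⁺ ≤ w n + (1 / 2 : ℝ) ^ n • s :=
      (posPart_mono (sub_le_sub_right (le_posPart _) _)).trans (posPart_sub_le_add (hr n))
    have h2 := (norm_le_norm_of_nonneg_of_le (posPart_nonneg _) h1).trans (norm_add_le _ _)
    have h3 : ‖(1 / 2 : ℝ) ^ n • s‖ = (1 / 2 : ℝ) ^ n * ‖s‖ := by
      rw [norm_smul, norm_pow]; norm_num
    linarith [hx2 n]
  choose h hh0 hh1 hhw using fun n => exists_nonneg_norming (hw n)
  have hweak := tendsto_apply_bandOperator hF hw hd hh1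
  have hbound : ∀ n, ‖bandOperator (hw n) (h n)‖ ≤ 2 := fun n => by
    refine ((bandOperator (hw n)).le_of_opNorm_le_of_le
      (LinearMap.mkContinuous_norm_le _ zero_le_two _) (hh1 n)).trans ?_
    norm_num
  have hlim := tendsto_apply_of_weakly_null hT_bdd hT (fun n => bandOperator_nonneg (hw n) (hh0 n))
    hweak hbound hx1
  have hpow : Tendsto (fun n : ℕ => ε / 2 - (1 / 2 : ℝ) ^ n * ‖s‖) atTop (𝓝 (ε / 2 - 0 * ‖s‖)) :=
    ((tendsto_pow_atTop_nhds_zero_of_lt_one (by norm_num) (by norm_num)).mul_const _).const_sub _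
  -- Passing to the limit gives `ε / 2 ≤ 0`.
  have := le_of_tendsto_of_tendsto' hpow hlim fun n =>
    (hwnorm n).trans ((hhw n).trans (le_bandOperator_apply (hw n) (hwle n) (hh0 n)))
  linarith
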